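/- **Setting.** Let $1\le n\le N$. For a subspace $\mathcal V\subset\mathbb R^N$ with an orthonormal basis matrix $V$, let $\gamma_i(\mathcal V)=\frac{N}{\dim\mathcal V}\|V^Te_i\|_2^2$ be its local coherence, $i=1,\dots,N$; for another subspace $\mathcal V'$ with orthonormal basis matrix $V'$, let $d(\mathcal V',\mathcal V)=\|V'-VV^TV'\|_F^2$. Let $U,\bar U\in\mathbb R^{N\times n}$ have orthonormal columns and column spaces $\mathcal U_k,\bar{\mathcal U}_{k+1}$. Let $P=[e_{p_1},\dots,e_{p_n}]\in\mathbb R^{N\times n}$ be an interpolation points matrix with $P^TU$ regular and $P^T\bar U$ of full rank $n$, and let $\Lambda_k=\|(P^TU)^{-1}\|_2$. Let $j_1,\dots,j_N$ be an ordering of $\{1,\dots,N\}$ with $$\gamma_{j_i}(\mathcal U_k)\le c_4e^{-c_5i^{a}},\qquad \gamma_{j_i}(\bar{\mathcal U}_{k+1})\le\bar c_4e^{-\bar c_5i^{\bar a}},\qquad i=1,\dots,N,$$ where $c_4,\bar c_4,c_5,\bar c_5>0$ and $a,\bar a>1$. Let $F=\bar U\tilde F$, where the entries of the random matrix $\tilde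 F\in\mathbb R^{n\times n}$ are i.i.d. standard Gaussian, and let $C=(P^TU)^{-1}P^TF$ and $R=UC-F$. **Adaptive sampling.** Given $m\le N$, order the indices so that $\|R^Te_i\|_2^2$ is decreasing (ties broken in any way), and let $S=[e_{s_1},\dots,e_{s_m}]$ belong to the first $m$ of them. **Full-rank ADEIM update.** Let $r$ be the rank of $S^TR$. A full-rank ADEIM update is a matrix $\alpha\beta^T$ with $\alpha\in\mathbb R^{N\times r}$, $\beta\in\mathbb R^{n\times r}$ whose rows outside the sampling points vanish and which minimizes $\|S^T((U+\alpha\beta^T)C-F)\|_F^2$ among all products $\alpha\beta^T$ of this size. The adapted space $\mathcal U_{k+1}$ is the column space of $U+\alpha\beta^T$. **Proposition.** There is a constant $c_8>0$, which depends only on $n,\Lambda_k,c_4,\bar c_4,c_5,\bar c_5$ (in particular not on $m$, $a$, $\bar a$), such that for all $\epsilon,\delta>0$ and all $m\le N$ with $$m\ge\min\left\{N,\left(\max\left\{0,-\frac{1}{\min\{c_5,\bar c_5\}}\log\left(\frac{\epsilon\,\delta^2N}{c_8\,n}\right)\right\}\right)^{1/\min\{a,\bar a\}}\right\},$$ with probability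 at least $1-\delta$ every full-rank ADEIM update with $m$ adaptively chosen sampling points yields an $n$-dimensional space $\mathcal U_{k+1}$ with $d(\bar{\mathcal U}_{k+1},\mathcal U_{k+1})\le\epsilon$. -/

import Mathlib

open scoped Matrix

noncomputable section

/-- Squared Frobenius norm. -/
def frobSq {ι κ : Type*} [Fintype ι] [Fintype κ] (M : Matrix ι κ ℝ) : ℝ :=
  ∑ i, ∑ j, M i j ^ 2

/-- Spectral norm of a square matrix: the operator norm on Euclidean space. -/
def spectralNorm2 {n : ℕ} (M : Matrix (Fin n) (Fin n) ℝ) : ℝ :=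
  ‖Matrix.toEuclideanCLM (n := Fin n) (𝕜 := ℝ) M‖

/-- The space spanned by the columns of a matrix, as a subspace of Euclidean space. -/
def colSpace {N n : ℕ} (U : Matrix (Fin N) (Fin n) ℝ) : Submodule ℝ (EuclideanSpace ℝ (Fin N)) :=
  Submodule.span ℝ (Set.range fun j => WithLp.toLp 2 (fun i => U i j))

/-- A matrix whose columns are an orthonormal basis of the subspace `V`. The notions built on it
below do not depend on which orthonormal basis is taken. -/
def basisMatrix {N : ℕ} (V : Submodule ℝ (EuclideanSpace ℝ (Fin N))) :
    Matrix (Fin N) (Fin (Module.finrank ℝ V)) ℝ :=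
  Matrix.of fun i j => (stdOrthonormalBasis ℝ V j : EuclideanSpace ℝ (Fin N)) i

/-- The distance `d(V', V) = ‖U' - U Uᵀ U'‖_F ^ 2`, with orthonormal basis matrices `U'` of `V'`
and `U` of `V`. -/
def subspaceDist {N : ℕ} (V' V : Submodule ℝ (EuclideanSpace ℝ (Fin N))) : ℝ :=
  frobSq (basisMatrix V' - basisMatrix V * (basisMatrix V)ᵀ * basisMatrix V')

/-- The local coherence `γ_i(V) = (N / dim V) * ‖Uᵀ e_i‖ ^ 2`, with an orthonormal basis matrix
`U` of `V`. -/
def localCoherence {N : ℕ} (V : Submodule ℝ (EuclideanSpace ℝ (Fin N))) (i : Fin N) : ℝ :=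
  (N : ℝ) / (Module.finrank ℝ V : ℝ) * ∑ j, basisMatrix V i j ^ 2

/-- The matrix `[e_{s_1}, …, e_{s_m}]` of canonical unit vectors that belongs to the points `s`
(interpolation points or sampling points). -/
def pointsMatrix {N m : ℕ} (s : Fin m → Fin N) : Matrix (Fin N) (Fin m) ℝ :=
  Matrix.of fun i l => if i = s l then 1 else 0

/-- The coefficient matrix `C = (Pᵀ U)⁻¹ Pᵀ F` of the interpolant. -/
def deimCoeff {N n w : ℕ} (U : Matrix (Fin N) (Fin n) ℝ) (p : Fin n → Fin N)
    (F : Matrix (Fin N) (Fin w) ℝ) : Matrix (Fin n) (Fin w) ℝ :=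
  ((pointsMatrix p)ᵀ * U)⁻¹ * ((pointsMatrix p)ᵀ * F)

/-- The residual `R = U C - F` of the interpolant. -/
def deimResidual {N n w : ℕ} (U : Matrix (Fin N) (Fin n) ℝ) (p : Fin n → Fin N)
    (F : Matrix (Fin N) (Fin w) ℝ) : Matrix (Fin N) (Fin w) ℝ :=
  U * deimCoeff U p F - F

/-- The component-wise residual `r_i = ‖Rᵀ e_i‖ ^ 2`. -/
def rowResidual {N w : ℕ} (R : Matrix (Fin N) (Fin w) ℝ) (i : Fin N) : ℝ :=
  ∑ l, R i l ^ 2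

/-- `s` consists of the first `m` points of an ordering of all points by decreasing component-wise
residual (ties may be broken in any way). -/
def IsAdaptiveSampling {N w m : ℕ} (hm : m ≤ N) (R : Matrix (Fin N) (Fin w) ℝ)
    (s : Fin m → Fin N) : Prop :=
  ∃ σ : Equiv.Perm (Fin N), Antitone (fun i => rowResidual R (σ i)) ∧
    ∀ l, s l = σ (Fin.castLE hm l)

/-- `α βᵀ` is a rank-`r` ADEIM update of `U` with sampling points `s`, coefficient matrix `C` and
right-hand side `F`: it changes only the rows of `U` at the sampling points, and among all matrices
of the form `α' β'ᵀ` with `r` columns in `α'` and `β'`, it minimizes the residual at the sampling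
points in the Frobenius norm. -/
structure IsADEIMUpdate {N n w m r : ℕ} (U : Matrix (Fin N) (Fin n) ℝ)
    (C : Matrix (Fin n) (Fin w) ℝ) (F : Matrix (Fin N) (Fin w) ℝ) (s : Fin m → Fin N)
    (α : Matrix (Fin N) (Fin r) ℝ) (β : Matrix (Fin n) (Fin r) ℝ) : Prop where
  eq_zero_off : ∀ i, i ∉ Set.range s → ∀ l, (α * βᵀ) i l = 0
  minimal : ∀ (α' : Matrix (Fin N) (Fin r) ℝ) (β' : Matrix (Fin n) (Fin r) ℝ),
    frobSq ((pointsMatrix s)ᵀ * ((U + α * βᵀ) * C - F)) ≤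
      frobSq ((pointsMatrix s)ᵀ * ((U + α' * β'ᵀ) * C - F))

end

theorem basisMatrix_orthonormal {N : ℕ} (V : Submodule ℝ (EuclideanSpace ℝ (Fin N))) :
    (basisMatrix V)ᵀ * basisMatrix V = 1 := by
  ext a b
  have h := (orthonormal_iff_ite.mp (stdOrthonormalBasis ℝ V).orthonormal) a b
  rw [Submodule.coe_inner, PiLp.inner_apply] at h
  simp only [Matrix.mul_apply, Matrix.transpose_apply, basisMatrix, Matrix.of_apply,
    Matrix.one_apply]
  rw [← h]
  refine Finset.sum_congr rfl fun i _ => ?_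
  simp [mul_comm]

theorem mem_colSpace_iff {N n : ℕ} (U : Matrix (Fin N) (Fin n) ℝ)
    (x : EuclideanSpace ℝ (Fin N)) :
    x ∈ colSpace U ↔ ∃ y : Fin n → ℝ, ∀ i, x i = (U *ᵥ y) i := by
  rw [colSpace, Submodule.mem_span_range_iff_exists_fun]
  constructor
  · rintro ⟨c, rfl⟩
    refine ⟨c, fun i => ?_⟩
    simp [Matrix.mulVec, dotProduct, mul_comm]
  · rintro ⟨y, hy⟩
    refine ⟨y, ?_⟩
    ext i
    rw [hy]
    simp [Matrix.mulVec, dotProduct, mul_comm]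

/-- All orthonormal basis matrices of a space give the same projection matrix. -/
theorem basisMatrix_colSpace {N n : ℕ} (Q : Matrix (Fin N) (Fin n) ℝ) (hQ : Qᵀ * Q = 1) :
    basisMatrix (colSpace Q) * (basisMatrix (colSpace Q))ᵀ = Q * Qᵀ := by
  set B := basisMatrix (colSpace Q) with hB
  have hBB : Bᵀ * B = 1 := basisMatrix_orthonormal _
  have h1 : ∃ X : Matrix (Fin n) (Fin (Module.finrank ℝ (colSpace Q))) ℝ, B = Q * X := by
    have : ∀ j, ∃ y : Fin n → ℝ, ∀ i, B i j = (Q *ᵥ y) i := fun j =>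
      (mem_colSpace_iff Q _).mp (stdOrthonormalBasis ℝ (colSpace Q) j).2
    choose y hy using this
    refine ⟨Matrix.of fun a b => y b a, ?_⟩
    ext i j
    rw [hy]
    simp [Matrix.mulVec, dotProduct, Matrix.mul_apply']
  have h2 : ∃ Y : Matrix (Fin (Module.finrank ℝ (colSpace Q))) (Fin n) ℝ, Q = B * Y := by
    have : ∀ j : Fin n, ∃ c : Fin (Module.finrank ℝ (colSpace Q)) → ℝ,
        ∀ i, Q i j = (B *ᵥ c) i := fun j => by
      have hmem : (WithLp.toLp 2 (fun i => Q i j) : EuclideanSpace ℝ (Fin N)) ∈ colSpace Q :=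
        Submodule.subset_span ⟨j, rfl⟩
      let b := stdOrthonormalBasis ℝ (colSpace Q)
      refine ⟨fun l => b.repr ⟨_, hmem⟩ l, fun i => ?_⟩
      have := congrArg (fun v : colSpace Q => (v : EuclideanSpace ℝ (Fin N)) i)
        (b.sum_repr ⟨_, hmem⟩)
      simp only [Submodule.coe_sum, Submodule.coe_smul] at this
      have h' : Q i j = _ := this.symm
      rw [h']
      simp [Matrix.mulVec, dotProduct, hB, basisMatrix, mul_comm, b]
    choose c hc using this
    refine ⟨Matrix.of fun a b => c b a, ?_⟩
    ext i j
    rw [hc]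
    simp [Matrix.mulVec, dotProduct, Matrix.mul_apply']
  obtain ⟨X, hX⟩ := h1
  obtain ⟨Y, hY⟩ := h2
  have e1 : Q * Qᵀ * B = B := by
    calc Q * Qᵀ * B = Q * Qᵀ * (Q * X) := by rw [hX]
      _ = Q * ((Qᵀ * Q) * X) := by simp only [Matrix.mul_assoc]
      _ = B := by rw [hQ, Matrix.one_mul, hX]
  have e2 : B * Bᵀ * Q = Q := by
    calc B * Bᵀ * Q = B * ((Bᵀ * B) * Y) := by
          simp only [Matrix.mul_assoc]; exact congrArg (fun M => B * (Bᵀ * M)) hY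
      _ = Q := by rw [hBB, Matrix.one_mul]; exact hY.symm
  have f1 : Q * Qᵀ * (B * Bᵀ) = B * Bᵀ := by rw [← Matrix.mul_assoc, e1]
  have f2 : B * Bᵀ * (Q * Qᵀ) = Q * Qᵀ := by rw [← Matrix.mul_assoc, e2]
  have f3 := congrArg Matrix.transpose f2
  simp only [Matrix.transpose_mul, Matrix.transpose_transpose] at f3
  rw [← f1, f3]

theorem frobSq_eq_trace {ι κ : Type*} [Fintype ι] [Fintype κ] (M : Matrix ι κ ℝ) :
    frobSq M = (M * Mᵀ).trace := by
  simp [frobSq, Matrix.trace, Matrix.mul_apply, sq]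

/-- The distance does not depend on the choice of the orthonormal bases. -/
theorem subspaceDist_colSpace {N n n' : ℕ} (Q' : Matrix (Fin N) (Fin n') ℝ)
    (Q : Matrix (Fin N) (Fin n) ℝ) (hQ' : Q'ᵀ * Q' = 1) (hQ : Qᵀ * Q = 1) :
    subspaceDist (colSpace Q') (colSpace Q) = frobSq (Q' - Q * Qᵀ * Q') := by
  have key : ∀ {k : ℕ} (A : Matrix (Fin N) (Fin N) ℝ) (B : Matrix (Fin N) (Fin k) ℝ),
      frobSq (B - A * B) = ((1 - A) * (B * Bᵀ) * (1 - A)ᵀ).trace := by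
    intro k A B
    rw [frobSq_eq_trace, show B - A * B = (1 - A) * B by rw [Matrix.sub_mul, Matrix.one_mul],
      Matrix.transpose_mul]
    simp only [Matrix.mul_assoc]
  rw [subspaceDist, key, key, basisMatrix_colSpace Q hQ, basisMatrix_colSpace Q' hQ']

theorem finrank_colSpace {N n : ℕ} (Q : Matrix (Fin N) (Fin n) ℝ) (hQ : Qᵀ * Q = 1) :
    Module.finrank ℝ (colSpace Q) = n := by
  have h := congrArg Matrix.trace (basisMatrix_colSpace Q hQ)
  rw [Matrix.trace_mul_comm, basisMatrix_orthonormal, Matrix.trace_mul_comm, hQ] at h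
  simpa using h

/-- The local coherence does not depend on the choice of the orthonormal basis. -/
theorem localCoherence_colSpace {N n : ℕ} (Q : Matrix (Fin N) (Fin n) ℝ) (hQ : Qᵀ * Q = 1)
    (i : Fin N) :
    localCoherence (colSpace Q) i = (N : ℝ) / (n : ℝ) * ∑ j, Q i j ^ 2 := by
  have h := congrFun (congrFun (basisMatrix_colSpace Q hQ) i) i
  simp only [Matrix.mul_apply, Matrix.transpose_apply, ← sq] at h
  rw [localCoherence, h, finrank_colSpace Q hQ]

/-! Write `G` for the Gaussian factor and `Q` for the orthonormal basis matrix of the target space,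
so that `F = Q * G`. If `C` is regular, a full-rank update can cancel the residual at all sampling
points, hence every minimizer does, and `(U + α βᵀ) C = F + R_off`, where `R_off` is `R` with the
sampled rows set to zero (`IsADEIMUpdate.mul_coeff_eq`). Multiplying by `G⁻¹` exhibits `Q + R_off
G⁻¹` inside the adapted space, so the distance is at most `‖R_off‖² ‖G⁻¹‖²` in Frobenius norms. The
dimension is `n` because `R` vanishes at the interpolation points, so the update leaves `Pᵀ(U + α
βᵀ) C = Pᵀ F`, a regular matrix (`IsADEIMUpdate.finrank_and_subspaceDist_le`).

The residual is linear in the right-hand side: `R` is the residual of `Q` times `G`. Its rows are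
bounded by those of `U` and `Q`, that is, by the local coherences, times `‖G‖²`. Adaptive sampling
removes the largest rows, so what remains is at most the tail along the given ordering, and this
tail is comparable to `exp(-c m^A)` with a constant free of `m` and the exponents
(`IsAdaptiveSampling.frobSq_rowsOff_le`).

What is left is the Frobenius condition number `‖G‖² ‖G⁻¹‖²`, at most `64 n^10 / δ²` with
probability at least `1 - δ` (`pi_gaussian_condition_le`). Since `G⁻¹ = adj G / det G`, a large
value forces the determinant to be small relative to its largest cofactor. The determinant is affine
in the matching entry, with this cofactor as slope, so that entry must lie in a short interval; a
union bound over the `n²` entries finishes the estimate. -/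

section

open MeasureTheory ProbabilityTheory

/-! ### Gaussian estimates and slices of product measures. -/

/-- The standard Gaussian density is at most `1`, so the law is dominated by Lebesgue measure. -/
theorem gaussianReal_closedBall_le (c ρ : ℝ) :
    gaussianReal 0 1 (Metric.closedBall c ρ) ≤ ENNReal.ofReal (2 * ρ) := by
  have hle : gaussianReal 0 1 ≤ (volume : Measure ℝ) := by
    rw [gaussianReal_of_var_ne_zero 0 one_ne_zero]
    conv_rhs => rw [← withDensity_one (μ := (volume : Measure ℝ))]
    refine withDensity_mono (ae_of_all _ fun x => ?_)
    rw [gaussianPDF_def, Pi.one_apply, ← ENNReal.ofReal_one]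
    refine ENNReal.ofReal_le_ofReal ?_
    rw [gaussianPDFReal_def]
    have h1 : (1 : ℝ) ≤ √(2 * Real.pi * ((1 : NNReal) : ℝ)) := by
      rw [Real.one_le_sqrt]
      have := Real.pi_gt_three
      push_cast
      linarith
    have h2 : Real.exp (-(x - 0) ^ 2 / (2 * ((1 : NNReal) : ℝ))) ≤ 1 := by
      rw [Real.exp_le_one_iff]
      push_cast
      nlinarith [sq_nonneg x]
    exact mul_le_one₀ (inv_le_one_of_one_le₀ h1) (Real.exp_nonneg _) h2
  calc gaussianReal 0 1 (Metric.closedBall c ρ) ≤ volume (Metric.closedBall c ρ) := hle _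
    _ = ENNReal.ofReal (2 * ρ) := Real.volume_closedBall c ρ

/-- Follows from `|x| ≤ (1 + x²) / 2` and unit variance. -/
theorem lintegral_abs_gaussianReal_le :
    ∫⁻ x, ENNReal.ofReal |x| ∂(gaussianReal 0 1) ≤ 1 := by
  have hsq : Integrable (fun x : ℝ => x ^ 2) (gaussianReal 0 1) :=
    (memLp_id_gaussianReal (μ := 0) (v := 1) 2).integrable_sq
  have hv : ∫ x, x ^ 2 ∂(gaussianReal 0 1) = 1 := by
    have h := variance_id_gaussianReal (μ := 0) (v := 1)
    rw [variance_of_integral_eq_zero aemeasurable_id (by simp)] at h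
    simpa using h
  have h1 : ∫ x, (1 + x ^ 2) / 2 ∂(gaussianReal 0 1) = 1 := by
    rw [integral_div, integral_add (integrable_const _) hsq, hv]
    simp
  calc ∫⁻ x, ENNReal.ofReal |x| ∂(gaussianReal 0 1)
      ≤ ∫⁻ x, ENNReal.ofReal ((1 + x ^ 2) / 2) ∂(gaussianReal 0 1) := by
        refine lintegral_mono fun x => ENNReal.ofReal_le_ofReal ?_
        nlinarith [sq_nonneg (|x| - 1), sq_abs x]
    _ = 1 := by
        rw [← ofReal_integral_eq_lintegral_ofReal, h1, ENNReal.ofReal_one]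
        · exact ((integrable_const _).add hsq).div_const _
        · exact ae_of_all _ fun x => by positivity

/-- Fubini in one coordinate of a product of probability measures. -/
theorem lintegral_pi_eq_lintegral_update {ι : Type*} [Fintype ι] [DecidableEq ι]
    (ν : ι → Measure ℝ) [∀ i, IsProbabilityMeasure (ν i)] (i : ι)
    (f : (ι → ℝ) → ENNReal) (hf : Measurable f) :
    ∫⁻ x, f x ∂Measure.pi ν = ∫⁻ x, ∫⁻ y, f (Function.update x i y) ∂ν i ∂Measure.pi ν := by
  have hg : Measurable fun x : ι → ℝ => ∫⁻ y, f (Function.update x i y) ∂ν i := by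
    have : Measurable fun z : (ι → ℝ) × ℝ => f (Function.update z.1 i z.2) := by
      refine hf.comp ?_
      exact measurable_update'
    exact this.lintegral_prod_right'
  rw [lintegral_eq_lmarginal_univ (0 : ι → ℝ), lintegral_eq_lmarginal_univ (0 : ι → ℝ),
    lmarginal_erase' f hf (Finset.mem_univ i), lmarginal_erase' _ hg (Finset.mem_univ i)]
  simp

/-- Conditioning on all coordinates but one: this turns one-variable estimates for a random entry
into estimates for the random matrix. -/
theorem pi_le_lintegral_of_slice_le {ι : Type*} [Fintype ι] [DecidableEq ι]
    (ν : ι → Measure ℝ) [∀ i, IsProbabilityMeasure (ν i)] (i : ι) {A : Set (ι → ℝ)}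
    (hA : MeasurableSet A) (f : (ι → ℝ) → ENNReal)
    (h : ∀ x, ν i {y | Function.update x i y ∈ A} ≤ f x) :
    Measure.pi ν A ≤ ∫⁻ x, f x ∂Measure.pi ν := by
  rw [← lintegral_indicator_one hA,
    lintegral_pi_eq_lintegral_update ν i _ (measurable_one.indicator hA)]
  refine lintegral_mono fun x => le_trans (le_of_eq ?_) (h x)
  have hm : MeasurableSet {y | Function.update x i y ∈ A} :=
    (measurable_update x) hA
  rw [← lintegral_indicator_one hm]
  rfl

/-! ### The determinant as an affine function of one entry, and the Gaussian condition number. -/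

/-- The square matrix with the given family of entries. -/
def matrixOfEntries {n : ℕ} (x : Fin n × Fin n → ℝ) : Matrix (Fin n) (Fin n) ℝ :=
  Matrix.of fun i j => x (i, j)

theorem continuous_matrixOfEntries {n : ℕ} :
    Continuous (matrixOfEntries : (Fin n × Fin n → ℝ) → Matrix (Fin n) (Fin n) ℝ) := by
  unfold matrixOfEntries
  fun_prop

theorem matrixOfEntries_update_updateRow {n : ℕ} (x : Fin n × Fin n → ℝ) (i k : Fin n) (y : ℝ)
    (v : Fin n → ℝ) :
    (matrixOfEntries (Function.update x (i, k) y)).updateRow i v =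
      (matrixOfEntries x).updateRow i v := by
  ext a b
  by_cases h : a = i
  · subst h; simp
  · simp [matrixOfEntries, h]

/-- Cofactors along row `i` do not see row `i`; so in the expansion along this row the determinant
is affine in each single entry. -/
theorem adjugate_matrixOfEntries_update {n : ℕ} (x : Fin n × Fin n → ℝ) (i k j : Fin n) (y : ℝ) :
    (matrixOfEntries (Function.update x (i, k) y)).adjugate j i =
      (matrixOfEntries x).adjugate j i := by
  rw [Matrix.adjugate_apply, Matrix.adjugate_apply, matrixOfEntries_update_updateRow]

/-- The matrix `M` with the rows outside `s` replaced by those of the identity. -/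
def keepRows {n : ℕ} (s : Finset (Fin n)) (M : Matrix (Fin n) (Fin n) ℝ) :
    Matrix (Fin n) (Fin n) ℝ :=
  Matrix.of fun i => if i ∈ s then M i else Pi.single i 1

/-- Induction from the identity, one random row at a time. With the new row `i`, the determinant is
affine in the entry `(i, i)`, and its slope is the determinant of the previous stage, which is
almost surely nonzero; so at most one value of that entry is bad. -/
theorem pi_det_keepRows_eq_zero {n : ℕ} (ν : Fin n × Fin n → Measure ℝ)
    [∀ q, IsProbabilityMeasure (ν q)] [∀ q, NullSingletonClass (ν q)] (s : Finset (Fin n)) :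
    Measure.pi ν {x | (keepRows s (matrixOfEntries x)).det = 0} = 0 := by
  have hcont : ∀ s : Finset (Fin n), Continuous fun x : Fin n × Fin n → ℝ =>
      (keepRows s (matrixOfEntries x)).det := fun s => by
    refine Continuous.matrix_det ?_
    refine continuous_matrix fun i j => ?_
    by_cases h : i ∈ s
    · simpa [keepRows, h, matrixOfEntries] using continuous_apply (i, j)
    · simpa [keepRows, h] using continuous_const
  induction s using Finset.induction with
  | empty =>
    have : keepRows (∅ : Finset (Fin n)) = fun _ => 1 := by
      ext M i j
      simp [keepRows, Matrix.one_apply, Pi.single_apply, eq_comm]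
    simp [this]
  | insert i s hi ih =>
    set Z : Finset (Fin n) → Set (Fin n × Fin n → ℝ) :=
      fun s => {x | (keepRows s (matrixOfEntries x)).det = 0} with hZ
    have hZm : ∀ s, MeasurableSet (Z s) := fun s =>
      (isClosed_singleton.preimage (hcont s)).measurableSet
    have hrow : ∀ x, (keepRows (insert i s) (matrixOfEntries x)).updateRow i (Pi.single i 1) =
        keepRows s (matrixOfEntries x) := fun x => by
      ext a b
      by_cases h : a = i
      · subst h; simp [keepRows, hi]
      · simp [keepRows, h]
    have hupd : ∀ x y (v : Fin n → ℝ),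
        (keepRows (insert i s) (matrixOfEntries (Function.update x (i, i) y))).updateRow i v =
        (keepRows (insert i s) (matrixOfEntries x)).updateRow i v := fun x y v => by
      ext a b
      by_cases h : a = i
      · subst h; simp
      · by_cases h' : a ∈ s <;> simp [keepRows, h, h', matrixOfEntries]
    have hadj : ∀ x y j,
        (keepRows (insert i s) (matrixOfEntries (Function.update x (i, i) y))).adjugate j i =
        (keepRows (insert i s) (matrixOfEntries x)).adjugate j i := fun x y j => by
      rw [Matrix.adjugate_apply, Matrix.adjugate_apply, hupd]
    have hdiff : Measure.pi ν (Z (insert i s) \ Z s) = 0 := by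
      refine le_antisymm ?_ bot_le
      refine (pi_le_lintegral_of_slice_le ν (i, i) ((hZm _).diff (hZm _)) (fun _ => 0)
        fun x => ?_).trans (by simp)
      refine le_of_eq (Set.Subsingleton.measure_zero (fun y hy z hz => ?_) _)
      have hslope : ∀ y, (keepRows (insert i s)
          (matrixOfEntries (Function.update x (i, i) y))).det =
          y * (keepRows (insert i s) (matrixOfEntries x)).adjugate i i +
          ∑ j ∈ Finset.univ.erase i,
            x (i, j) * (keepRows (insert i s) (matrixOfEntries x)).adjugate j i := fun y => by
        rw [Matrix.det_eq_sum_mul_adjugate_row _ i,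
          ← Finset.add_sum_erase _ _ (Finset.mem_univ i)]
        simp only [hadj]
        congr 1
        · simp [keepRows, matrixOfEntries]
        · refine Finset.sum_congr rfl fun j hj => ?_
          have : j ≠ i := Finset.ne_of_mem_erase hj
          simp [keepRows, matrixOfEntries, this]
      have hne : (keepRows (insert i s) (matrixOfEntries x)).adjugate i i ≠ 0 := by
        have h := hy.2
        simp only [hZ, Set.mem_ofPred_eq] at h
        rwa [← hrow, hupd, ← Matrix.adjugate_apply] at h
      have h1 := hslope y
      have h2 := hslope z
      rw [show (keepRows (insert i s)
          (matrixOfEntries (Function.update x (i, i) y))).det = 0 from hy.1] at h1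
      rw [show (keepRows (insert i s)
          (matrixOfEntries (Function.update x (i, i) z))).det = 0 from hz.1] at h2
      exact mul_right_cancel₀ hne (by linarith)
    refine measure_mono_null (t := (Z (insert i s) \ Z s) ∪ Z s) ?_ ?_
    · intro x hx
      by_cases h : x ∈ Z s
      · exact Or.inr h
      · exact Or.inl ⟨hx, h⟩
    · exact measure_union_null hdiff ih

theorem pi_det_eq_zero {n : ℕ} (ν : Fin n × Fin n → Measure ℝ)
    [∀ q, IsProbabilityMeasure (ν q)] [∀ q, NullSingletonClass (ν q)] :
    Measure.pi ν {x | (matrixOfEntries x).det = 0} = 0 := by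
  have h := pi_det_keepRows_eq_zero ν Finset.univ
  have : ∀ M : Matrix (Fin n) (Fin n) ℝ, keepRows Finset.univ M = M := fun M => by
    ext; simp [keepRows]
  simpa only [this] using h

/-- An affine function of one variable with slope `q` is small, relative to the variable and the
rest `ρ`, only on an interval of length proportional to `ρ`. -/
theorem mem_closedBall_of_affine_small {y q D ρ η : ℝ} (hq : q ≠ 0)
    (hη : 0 ≤ η) (hη' : η ≤ 1 / 2) (hD : |D| ≤ ρ * |q|)
    (h : |y * q + D| ≤ η * (|y| + ρ) * |q|) : y ∈ Metric.closedBall (-(D / q)) (4 * η * ρ) := by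
  have hq' : 0 < |q| := abs_pos.mpr hq
  rw [Metric.mem_closedBall, Real.dist_eq, sub_neg_eq_add]
  have e : y * q + D = (y + D / q) * q := by field_simp
  rw [e, abs_mul] at h
  have h1 : |y + D / q| ≤ η * (|y| + ρ) := le_of_mul_le_mul_right h hq'
  have h2 : |D / q| ≤ ρ := by rw [abs_div, div_le_iff₀ hq']; exact hD
  have h3 : |y| ≤ |y + D / q| + ρ := by
    calc |y| = |(y + D / q) - D / q| := by ring_nf
      _ ≤ |y + D / q| + |D / q| := abs_sub _ _
      _ ≤ _ := by linarith
  -- With `t = y + D / q` this gives `|t| ≤ η (|t| + 2ρ)`, and `η ≤ 1/2` absorbs the `|t|` on the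
  -- right.
  have h4 : η * |y| ≤ η * (|y + D / q| + ρ) := mul_le_mul_of_nonneg_left h3 hη
  have h5 : η * |y + D / q| ≤ 1 / 2 * |y + D / q| :=
    mul_le_mul_of_nonneg_right hη' (abs_nonneg _)
  nlinarith

/-- Fix all entries except `(i, k)`. As the cofactor `(k, i)` dominates its column of the adjugate,
the constant term of the affine function is at most `ρ` times the slope, with `ρ` the sum of the
other absolute entries. The free entry is then confined to an interval of length `8 η ρ`, and the
mean of `ρ` is at most `n²`. -/
theorem pi_gaussian_small_det_le {n : ℕ} (i k : Fin n) {η : ℝ} (hη : 0 ≤ η) (hη' : η ≤ 1 / 2) :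
    Measure.pi (fun _ : Fin n × Fin n => gaussianReal 0 1)
      {x | (∀ j, |(matrixOfEntries x).adjugate j i| ≤ |(matrixOfEntries x).adjugate k i|) ∧
        (matrixOfEntries x).adjugate k i ≠ 0 ∧
        |(matrixOfEntries x).det| ≤ η * (∑ q, |x q|) * |(matrixOfEntries x).adjugate k i|} ≤
      ENNReal.ofReal (8 * η * n ^ 2) := by
  have hadj : Continuous fun x : Fin n × Fin n → ℝ => (matrixOfEntries x).adjugate :=
    continuous_matrixOfEntries.matrix_adjugate
  have hadj' : ∀ j l, Continuous fun x : Fin n × Fin n → ℝ => (matrixOfEntries x).adjugate j l :=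
    fun j l => hadj.matrix_elem j l
  have hdet : Continuous fun x : Fin n × Fin n → ℝ => (matrixOfEntries x).det :=
    continuous_matrixOfEntries.matrix_det
  refine (pi_le_lintegral_of_slice_le _ (i, k) ?_
    (fun x => ENNReal.ofReal (8 * η) * ∑ q, ENNReal.ofReal |x q|) fun x => ?_).trans ?_
  · refine MeasurableSet.inter ?_ (MeasurableSet.inter ?_ ?_)
    · change MeasurableSet {x : Fin n × Fin n → ℝ | ∀ j, |(matrixOfEntries x).adjugate j i| ≤
          |(matrixOfEntries x).adjugate k i|}
      rw [show {x : Fin n × Fin n → ℝ | ∀ j, |(matrixOfEntries x).adjugate j i| ≤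
          |(matrixOfEntries x).adjugate k i|} = ⋂ j, {x | |(matrixOfEntries x).adjugate j i| ≤
          |(matrixOfEntries x).adjugate k i|} by ext; simp]
      exact MeasurableSet.iInter fun j =>
        (isClosed_le (hadj' j i).abs (hadj' k i).abs).measurableSet
    · exact (isOpen_ne_fun (hadj' k i) continuous_const).measurableSet
    · refine (isClosed_le hdet.abs (Continuous.mul (continuous_const.mul ?_)
        (hadj' k i).abs)).measurableSet
      exact continuous_finsetSum _ fun q _ => (continuous_apply q).abs
  · set M := matrixOfEntries x with hM
    set ρ := ∑ q ∈ Finset.univ.erase (i, k), |x q| with hρ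
    have hρ0 : 0 ≤ ρ := Finset.sum_nonneg fun _ _ => abs_nonneg _
    set D := ∑ j ∈ Finset.univ.erase k, x (i, j) * M.adjugate j i with hDdef
    refine (measure_mono (t := Metric.closedBall (-(D / M.adjugate k i)) (4 * η * ρ))
      ?_).trans ?_
    · rintro y ⟨h1, h2, h3⟩
      simp only [adjugate_matrixOfEntries_update, ← hM] at h1 h2 h3
      refine mem_closedBall_of_affine_small h2 hη hη' ?_ ?_
      · calc |D| ≤ ∑ j ∈ Finset.univ.erase k, |x (i, j) * M.adjugate j i| :=
              Finset.abs_sum_le_sum_abs _ _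
          _ ≤ ∑ j ∈ Finset.univ.erase k, |x (i, j)| * |M.adjugate k i| := by
              refine Finset.sum_le_sum fun j _ => ?_
              rw [abs_mul]
              exact mul_le_mul_of_nonneg_left (h1 j) (abs_nonneg _)
          _ = (∑ j ∈ Finset.univ.erase k, |x (i, j)|) * |M.adjugate k i| :=
              (Finset.sum_mul _ _ _).symm
          _ ≤ ρ * |M.adjugate k i| := by
              refine mul_le_mul_of_nonneg_right ?_ (abs_nonneg _)
              rw [← Finset.sum_image (s := Finset.univ.erase k) (g := fun j => (i, j))
                (f := fun q => |x q|) (fun a _ b _ h => (Prod.mk.inj h).2)]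
              refine Finset.sum_le_sum_of_subset_of_nonneg ?_ fun _ _ _ => abs_nonneg _
              intro q hq
              obtain ⟨j, hj, rfl⟩ := Finset.mem_image.mp hq
              simpa using hj
      · have e1 : (matrixOfEntries (Function.update x (i, k) y)).det =
            y * M.adjugate k i + D := by
          rw [Matrix.det_eq_sum_mul_adjugate_row _ i,
            ← Finset.add_sum_erase _ _ (Finset.mem_univ k)]
          simp only [adjugate_matrixOfEntries_update, ← hM]
          congr 1
          · simp [matrixOfEntries]
          · refine Finset.sum_congr rfl fun j hj => ?_
            have : j ≠ k := Finset.ne_of_mem_erase hj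
            simp [matrixOfEntries, this]
        have e2 : ∑ q, |Function.update x (i, k) y q| = |y| + ρ := by
          rw [← Finset.add_sum_erase _ _ (Finset.mem_univ (i, k)), Function.update_self]
          congr 1
          refine Finset.sum_congr rfl fun q hq => ?_
          rw [Function.update_of_ne (Finset.ne_of_mem_erase hq)]
        rw [← e1, ← e2]
        exact h3
    · refine (gaussianReal_closedBall_le _ _).trans ?_
      rw [← ENNReal.ofReal_sum_of_nonneg fun _ _ => abs_nonneg _,
        ← ENNReal.ofReal_mul (by positivity)]
      refine ENNReal.ofReal_le_ofReal ?_
      -- Putting the removed entry back only enlarges the bound and leaves a sum over all `n²`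
      -- entries to integrate.
      have : ρ ≤ ∑ q, |x q| := Finset.sum_le_sum_of_subset_of_nonneg (Finset.erase_subset _ _)
        fun _ _ _ => abs_nonneg _
      nlinarith
  · rw [lintegral_const_mul _ (by fun_prop), lintegral_finsetSum _ (by fun_prop),
      ENNReal.ofReal_mul (p := 8 * η) (by positivity)]
    refine mul_le_mul' le_rfl ?_
    calc ∑ q : Fin n × Fin n, ∫⁻ x, ENNReal.ofReal |x q|
            ∂(Measure.pi fun _ : Fin n × Fin n => gaussianReal 0 1)
        ≤ ∑ q : Fin n × Fin n, 1 := by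
          refine Finset.sum_le_sum fun q _ => ?_
          have hmp := measurePreserving_eval (fun _ : Fin n × Fin n => gaussianReal 0 1) q
          have := hmp.lintegral_comp (f := fun t => ENNReal.ofReal |t|) (by fun_prop)
          exact this.le.trans lintegral_abs_gaussianReal_le
      _ = ENNReal.ofReal ((n : ℝ) ^ 2) := by
          rw [ENNReal.ofReal_pow (by positivity), ENNReal.ofReal_natCast]
          simp [sq]

theorem frobSq_nonneg {ι κ : Type*} [Fintype ι] [Fintype κ] (M : Matrix ι κ ℝ) : 0 ≤ frobSq M :=
  Finset.sum_nonneg fun _ _ => Finset.sum_nonneg fun _ _ => sq_nonneg _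

/-- The tail of the condition number of a square Gaussian matrix. -/
theorem pi_gaussian_condition_le {n : ℕ} (hn : 1 ≤ n) {δ : ℝ} (hδ : 0 < δ) (hδ' : δ ≤ 1) :
    Measure.pi (fun _ : Fin n × Fin n => gaussianReal 0 1)
      {x | (matrixOfEntries x).det = 0 ∨ 64 * n ^ 10 / δ ^ 2 * (matrixOfEntries x).det ^ 2 <
        frobSq (matrixOfEntries x) * frobSq (matrixOfEntries x).adjugate} ≤
      ENNReal.ofReal δ := by
  have hn' : (1 : ℝ) ≤ n := by exact_mod_cast hn
  -- Chosen so that `n²` events of probability at most `8 η n²` add up to `δ`. Off these events and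
  -- the singular matrices, the squared condition number is at most `n² / η² = 64 n^10 / δ²`.
  set η : ℝ := δ / (8 * n ^ 4) with hη
  have hη0 : 0 ≤ η := by positivity
  have hη2 : η ≤ 1 / 2 := by
    rw [hη, div_le_iff₀ (by positivity)]
    have : (1 : ℝ) ≤ n ^ 4 := one_le_pow₀ hn'
    linarith
  set A : Fin n × Fin n → Set (Fin n × Fin n → ℝ) := fun q =>
    {x | (∀ j, |(matrixOfEntries x).adjugate j q.1| ≤ |(matrixOfEntries x).adjugate q.2 q.1|) ∧
        (matrixOfEntries x).adjugate q.2 q.1 ≠ 0 ∧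
        |(matrixOfEntries x).det| ≤
          η * (∑ q, |x q|) * |(matrixOfEntries x).adjugate q.2 q.1|} with hA
  have hsub : {x | (matrixOfEntries x).det = 0 ∨ 64 * n ^ 10 / δ ^ 2 *
        (matrixOfEntries x).det ^ 2 <
        frobSq (matrixOfEntries x) * frobSq (matrixOfEntries x).adjugate} ⊆
      {x | (matrixOfEntries x).det = 0} ∪ ⋃ q, A q := by
    rintro x (hx | hx)
    · exact Or.inl hx
    refine Or.inr (Set.mem_iUnion.mpr ?_)
    set M := matrixOfEntries x with hM
    have : Nonempty (Fin n) := ⟨⟨0, hn⟩⟩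
    obtain ⟨q, hq⟩ := Finite.exists_max fun q : Fin n × Fin n => |M.adjugate q.2 q.1|
    have hadj : frobSq M.adjugate ≤ n ^ 2 * M.adjugate q.2 q.1 ^ 2 := by
      calc frobSq M.adjugate ≤ ∑ _i : Fin n, ∑ _j : Fin n, M.adjugate q.2 q.1 ^ 2 :=
            Finset.sum_le_sum fun i _ => Finset.sum_le_sum fun j _ =>
              sq_le_sq.mpr (hq (j, i))
        _ = n ^ 2 * M.adjugate q.2 q.1 ^ 2 := by simp; ring
    have hMf : frobSq M ≤ (∑ q, |x q|) ^ 2 := by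
      calc frobSq M = ∑ q, |x q| ^ 2 := by
            simp [frobSq, hM, matrixOfEntries, Fintype.sum_prod_type]
        _ ≤ (∑ q, |x q|) ^ 2 := Finset.sum_sq_le_sq_sum_of_nonneg fun _ _ => abs_nonneg _
    have hmain : 64 * n ^ 10 / δ ^ 2 * M.det ^ 2 <
        (∑ q, |x q|) ^ 2 * (n ^ 2 * M.adjugate q.2 q.1 ^ 2) :=
      hx.trans_le (mul_le_mul hMf hadj (frobSq_nonneg _) (sq_nonneg _))
    refine ⟨q, fun j => hq (q.1, j), fun h0 => ?_, ?_⟩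
    · rw [h0] at hmain
      have : 0 ≤ 64 * n ^ 10 / δ ^ 2 * M.det ^ 2 := by positivity
      simp at hmain
      linarith
    · have hs : 0 ≤ ∑ q, |x q| := Finset.sum_nonneg fun _ _ => abs_nonneg _
      refine abs_le_of_sq_le_sq' ?_ (by positivity) |> abs_le.mpr
      rw [mul_pow, mul_pow, sq_abs, hη]
      have e : (δ / (8 * n ^ 4)) ^ 2 * (∑ q, |x q|) ^ 2 * M.adjugate q.2 q.1 ^ 2 =
          δ ^ 2 / (64 * n ^ 10) * ((∑ q, |x q|) ^ 2 * (n ^ 2 * M.adjugate q.2 q.1 ^ 2)) := by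
        field_simp; ring
      rw [e]
      calc M.det ^ 2 = δ ^ 2 / (64 * n ^ 10) * (64 * n ^ 10 / δ ^ 2 * M.det ^ 2) := by
            field_simp
        _ ≤ _ := mul_le_mul_of_nonneg_left hmain.le (by positivity)
  refine (measure_mono hsub).trans ((measure_union_le _ _).trans ?_)
  have : NullSingletonClass (gaussianReal 0 1) := nullSingletonClass_gaussianReal one_ne_zero
  rw [pi_det_eq_zero, zero_add]
  calc _ ≤ ∑ q, Measure.pi (fun _ : Fin n × Fin n => gaussianReal 0 1) (A q) :=
        measure_iUnion_fintype_le _ _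
    _ ≤ ∑ _q : Fin n × Fin n, ENNReal.ofReal (8 * η * n ^ 2) :=
        Finset.sum_le_sum fun q _ => pi_gaussian_small_det_le q.1 q.2 hη0 hη2
    _ = ENNReal.ofReal δ := by
        rw [← ENNReal.ofReal_sum_of_nonneg fun _ _ => by positivity]
        congr 1
        simp [hη]
        field_simp

theorem exists_measurableSet_gaussian_condition {Ω : Type*} [MeasurableSpace Ω] (μ : Measure Ω)
    [IsProbabilityMeasure μ] {n : ℕ} (hn : 1 ≤ n) (G : Ω → Matrix (Fin n) (Fin n) ℝ)
    (hG : ∀ x y, HasLaw (fun ω => G ω x y) (gaussianReal 0 1) μ)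
    (hind : iIndepFun (fun (q : Fin n × Fin n) ω => G ω q.1 q.2) μ) {δ : ℝ} (hδ : 0 < δ) :
    ∃ E : Set Ω, MeasurableSet E ∧ ENNReal.ofReal (1 - δ) ≤ μ E ∧ ∀ ω ∈ E,
      IsUnit (G ω).det ∧ frobSq (G ω) * frobSq (G ω)⁻¹ ≤ 64 * n ^ 10 / δ ^ 2 := by
  rcases le_or_gt 1 δ with h1 | h1
  -- For `δ ≥ 1` the required probability is zero.
  · exact ⟨∅, MeasurableSet.empty, by simp [h1], by simp⟩
  set B : Set (Fin n × Fin n → ℝ) :=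
    {x | (matrixOfEntries x).det = 0 ∨ 64 * n ^ 10 / δ ^ 2 * (matrixOfEntries x).det ^ 2 <
        frobSq (matrixOfEntries x) * frobSq (matrixOfEntries x).adjugate} with hB
  have hdet : Continuous fun x : Fin n × Fin n → ℝ => (matrixOfEntries x).det :=
    continuous_matrixOfEntries.matrix_det
  have hfrob : Continuous (frobSq : Matrix (Fin n) (Fin n) ℝ → ℝ) := by
    unfold frobSq
    exact continuous_finsetSum _ fun i _ => continuous_finsetSum _ fun j _ =>
      (continuous_id.matrix_elem i j).pow 2
  have hBm : MeasurableSet B := by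
    refine MeasurableSet.union (isClosed_singleton.preimage hdet).measurableSet ?_
    exact (isOpen_lt (continuous_const.mul (hdet.pow 2))
      ((hfrob.comp continuous_matrixOfEntries).mul
        (hfrob.comp continuous_matrixOfEntries.matrix_adjugate))).measurableSet
  set X : Ω → (Fin n × Fin n → ℝ) := fun ω q => G ω q.1 q.2 with hX
  have hXae : ∀ q : Fin n × Fin n, AEMeasurable (fun ω => X ω q) μ :=
    fun q => (hG q.1 q.2).aemeasurable
  have hlaw : μ.map X = Measure.pi fun _ : Fin n × Fin n => gaussianReal 0 1 := by
    have h := (iIndepFun_iff_map_fun_eq_pi_map hXae).mp hind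
    rw [hX, h]
    congr 1
    funext q
    exact (hG q.1 q.2).map_eq
  have hbad : μ (X ⁻¹' B) ≤ ENNReal.ofReal δ := by
    rw [← Measure.map_apply_of_aemeasurable (aemeasurable_pi_lambda _ hXae) hBm, hlaw]
    exact pi_gaussian_condition_le hn hδ h1.le
  -- The entries are only almost everywhere measurable, so the bad event is replaced by a measurable
  -- hull of the same measure.
  refine ⟨(toMeasurable μ (X ⁻¹' B))ᶜ, (measurableSet_toMeasurable _ _).compl, ?_, ?_⟩
  · rw [prob_compl_eq_one_sub (measurableSet_toMeasurable _ _), measure_toMeasurable,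
      ENNReal.ofReal_sub _ hδ.le, ENNReal.ofReal_one]
    exact tsub_le_tsub_left hbad _
  · intro ω hω
    have hω' : X ω ∉ B := fun h => hω (subset_toMeasurable μ _ h)
    have hGX : matrixOfEntries (X ω) = G ω := by ext; rfl
    simp only [hB, Set.mem_ofPred_eq, hGX, not_or, not_lt] at hω'
    obtain ⟨h0, hle⟩ := hω'
    refine ⟨isUnit_iff_ne_zero.mpr h0, ?_⟩
    have hpos : 0 < (G ω).det ^ 2 := by positivity
    have hinv : frobSq (G ω)⁻¹ = frobSq (G ω).adjugate / (G ω).det ^ 2 := by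
      simp only [frobSq, Matrix.inv_def, Matrix.smul_apply, smul_eq_mul, mul_pow,
        Ring.inverse_eq_inv', ← Finset.mul_sum]
      rw [inv_pow, div_eq_inv_mul]
    rw [hinv, ← mul_div_assoc, div_le_iff₀ hpos]
    exact hle

end

/-! ### Frobenius norms, row norms and point matrices. -/

theorem frobSq_mul_le {ι κ τ : Type*} [Fintype ι] [Fintype κ] [Fintype τ]
    (A : Matrix ι κ ℝ) (B : Matrix κ τ ℝ) : frobSq (A * B) ≤ frobSq A * frobSq B := by
  calc frobSq (A * B) ≤ ∑ i, ∑ j, (∑ k, A i k ^ 2) * ∑ k, B k j ^ 2 :=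
        Finset.sum_le_sum fun i _ => Finset.sum_le_sum fun j _ => by
          rw [Matrix.mul_apply]
          exact Finset.sum_mul_sq_le_sq_mul_sq _ _ _
    _ = frobSq A * frobSq B := by
        rw [frobSq, frobSq, Finset.sum_comm (f := fun k j => B k j ^ 2), Finset.sum_mul]
        simp only [Finset.mul_sum]

theorem frobSq_neg {ι κ : Type*} [Fintype ι] [Fintype κ] (M : Matrix ι κ ℝ) :
    frobSq (-M) = frobSq M := by
  simp [frobSq]

theorem frobSq_eq_zero_iff {ι κ : Type*} [Fintype ι] [Fintype κ] {M : Matrix ι κ ℝ} :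
    frobSq M = 0 ↔ M = 0 := by
  constructor
  · intro h
    ext i j
    have h1 := (Finset.sum_eq_zero_iff_of_nonneg
      fun i _ => Finset.sum_nonneg fun j _ => sq_nonneg (M i j)).mp h i (Finset.mem_univ i)
    have h2 := (Finset.sum_eq_zero_iff_of_nonneg
      fun j _ => sq_nonneg (M i j)).mp h1 j (Finset.mem_univ j)
    simpa using h2
  · rintro rfl
    simp [frobSq]

theorem frobSq_eq_trace_transpose_mul {ι κ : Type*} [Fintype ι] [Fintype κ]
    (M : Matrix ι κ ℝ) : frobSq M = (Mᵀ * M).trace := by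
  rw [frobSq_eq_trace, Matrix.trace_mul_comm]

theorem rowResidual_nonneg {N w : ℕ} (R : Matrix (Fin N) (Fin w) ℝ) (i : Fin N) :
    0 ≤ rowResidual R i :=
  Finset.sum_nonneg fun _ _ => sq_nonneg _

theorem rowResidual_mul_le {N w v : ℕ} (A : Matrix (Fin N) (Fin w) ℝ)
    (B : Matrix (Fin w) (Fin v) ℝ) (i : Fin N) :
    rowResidual (A * B) i ≤ rowResidual A i * frobSq B := by
  have h := frobSq_mul_le (Matrix.of fun (_ : Unit) => A i) B
  simpa [frobSq, rowResidual, Matrix.mul_apply] using h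

theorem frobSq_le_card_mul_spectralNorm2_sq {n : ℕ} (M : Matrix (Fin n) (Fin n) ℝ) :
    frobSq M ≤ n * spectralNorm2 M ^ 2 := by
  have hcol : ∀ j, ∑ i, M i j ^ 2 ≤ spectralNorm2 M ^ 2 := fun j => by
    have h := (Matrix.toEuclideanCLM (n := Fin n) (𝕜 := ℝ) M).le_opNorm
      (EuclideanSpace.single j 1)
    rw [PiLp.norm_single, norm_one, mul_one] at h
    have h2 := pow_le_pow_left₀ (norm_nonneg _) h 2
    rw [EuclideanSpace.norm_sq_eq] at h2
    refine le_trans (le_of_eq ?_) h2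
    refine Finset.sum_congr rfl fun i _ => ?_
    simp [Matrix.ofLp_toEuclideanCLM]
  rw [frobSq, Finset.sum_comm]
  exact (Finset.sum_le_sum fun j _ => hcol j).trans (by simp)

/-- Rows of a matrix with orthonormal columns have norm at most one. -/
theorem rowResidual_le_one_of_orthonormal {N n : ℕ} {U : Matrix (Fin N) (Fin n) ℝ}
    (hU : Uᵀ * U = 1) (i : Fin N) : rowResidual U i ≤ 1 := by
  -- The diagonal entry of the symmetric idempotent `H` is the squared norm of its row, so it is at
  -- least its own square.
  set H := U * Uᵀ with hH
  have hHH : H * Hᵀ = H := by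
    rw [hH, Matrix.transpose_mul, Matrix.transpose_transpose, Matrix.mul_assoc,
      ← Matrix.mul_assoc Uᵀ, hU, Matrix.one_mul]
  have hii : H i i = rowResidual U i := by
    simp [hH, Matrix.mul_apply, rowResidual, sq]
  have h1 : ∑ k, H i k ^ 2 = H i i := by
    have := congrFun (congrFun hHH i) i
    simpa [Matrix.mul_apply, sq] using this
  have h2 : H i i ^ 2 ≤ H i i := by
    conv_rhs => rw [← h1]
    exact Finset.single_le_sum (f := fun k => H i k ^ 2) (fun _ _ => sq_nonneg _)
      (Finset.mem_univ i)
  rw [← hii]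
  nlinarith

theorem pointsMatrix_transpose_mul_apply {N m w : ℕ} (s : Fin m → Fin N)
    (M : Matrix (Fin N) (Fin w) ℝ) (l : Fin m) (j : Fin w) :
    ((pointsMatrix s)ᵀ * M) l j = M (s l) j := by
  simp [pointsMatrix, Matrix.mul_apply]

theorem pointsMatrix_transpose_mul_self {N m : ℕ} {s : Fin m → Fin N}
    (hs : Function.Injective s) : (pointsMatrix s)ᵀ * pointsMatrix s = 1 := by
  ext a b
  rw [pointsMatrix_transpose_mul_apply]
  simp [pointsMatrix, Matrix.one_apply, hs.eq_iff]

/-! ### Full-rank updates at the sampling points. -/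

theorem exists_rank_factorization {m w : ℕ} (A : Matrix (Fin m) (Fin w) ℝ) :
    ∃ (X : Matrix (Fin m) (Fin A.rank) ℝ) (Y : Matrix (Fin A.rank) (Fin w) ℝ), A = X * Y := by
  let V := LinearMap.range A.mulVecLin
  let b : Module.Basis (Fin A.rank) ℝ V := Module.finBasis ℝ V
  have hmem : ∀ j, A.col j ∈ V := fun j => ⟨Pi.single j 1, by simp⟩
  refine ⟨Matrix.of fun i l => (b l : Fin m → ℝ) i,
    Matrix.of fun l j => b.repr ⟨A.col j, hmem j⟩ l, ?_⟩
  ext i j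
  have h := congrArg (fun v : V => (v : Fin m → ℝ) i) (b.sum_repr ⟨A.col j, hmem j⟩)
  simp only [Submodule.coe_sum, Submodule.coe_smul, Finset.sum_apply, Pi.smul_apply,
    smul_eq_mul] at h
  rw [Matrix.mul_apply]
  simp only [Matrix.of_apply]
  rw [show A i j = A.col j i from rfl, ← h]
  exact Finset.sum_congr rfl fun l _ => mul_comm _ _

/-- A full-rank update with a regular coefficient matrix has no residual at the sampling points. -/
theorem IsADEIMUpdate.residual_eq_zero {N n m r : ℕ} {U : Matrix (Fin N) (Fin n) ℝ}
    {C : Matrix (Fin n) (Fin n) ℝ} {F : Matrix (Fin N) (Fin n) ℝ} {s : Fin m → Fin N}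
    (hC : IsUnit C.det) (hs : Function.Injective s)
    (hr : r = ((pointsMatrix s)ᵀ * (U * C - F)).rank)
    {α : Matrix (Fin N) (Fin r) ℝ} {β : Matrix (Fin n) (Fin r) ℝ}
    (h : IsADEIMUpdate U C F s α β) (l : Fin m) (j : Fin n) :
    ((U + α * βᵀ) * C) (s l) j = F (s l) j := by
  subst hr
  obtain ⟨X, Y, hXY⟩ := exists_rank_factorization ((pointsMatrix s)ᵀ * (U * C - F))
  -- Competitor with zero sampled residual: multiplied by `C`, it subtracts exactly `Sᵀ R = X Y` at
  -- the sampling points.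
  have hmin := h.minimal (-(pointsMatrix s * X)) (Y * C⁻¹)ᵀ
  have h0 : (pointsMatrix s)ᵀ *
      ((U + -(pointsMatrix s * X) * (Y * C⁻¹)ᵀᵀ) * C - F) = 0 := by
    have e : (U + -(pointsMatrix s * X) * (Y * C⁻¹)ᵀᵀ) * C - F =
        (U * C - F) - pointsMatrix s * (X * Y) := by
      rw [Matrix.transpose_transpose, Matrix.add_mul, Matrix.neg_mul, Matrix.neg_mul]
      simp only [Matrix.mul_assoc]
      rw [Matrix.nonsing_inv_mul _ hC, Matrix.mul_one]
      abel
    rw [e, Matrix.mul_sub, ← Matrix.mul_assoc _ (pointsMatrix s),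
      pointsMatrix_transpose_mul_self hs, Matrix.one_mul, ← hXY, sub_self]
  rw [h0, frobSq_eq_zero_iff.mpr rfl] at hmin
  have hz := frobSq_eq_zero_iff.mp (le_antisymm hmin (frobSq_nonneg _))
  have := congrFun (congrFun hz l) j
  rw [pointsMatrix_transpose_mul_apply, Matrix.sub_apply, Matrix.zero_apply] at this
  linarith

/-! ### Distance to a column space and its dimension. -/

theorem colSpace_basisMatrix {N : ℕ} (V : Submodule ℝ (EuclideanSpace ℝ (Fin N))) :
    colSpace (basisMatrix V) = V := by
  have h : (Set.range fun j => WithLp.toLp 2 (fun i => basisMatrix V i j)) =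
      V.subtype '' Set.range (stdOrthonormalBasis ℝ V) := by
    rw [← Set.range_comp]
    rfl
  rw [colSpace, h, Submodule.span_image, ← OrthonormalBasis.coe_toBasis, Module.Basis.span_eq,
    Submodule.map_top, Submodule.range_subtype]

/-- Pythagoras: the squared norm drops by `‖Bᵀ X‖²`. -/
theorem frobSq_sub_projection_le {N k w : ℕ} {B : Matrix (Fin N) (Fin k) ℝ} (hB : Bᵀ * B = 1)
    (X : Matrix (Fin N) (Fin w) ℝ) : frobSq (X - B * Bᵀ * X) ≤ frobSq X := by
  have e : (X - B * Bᵀ * X)ᵀ * (X - B * Bᵀ * X) = Xᵀ * X - (Bᵀ * X)ᵀ * (Bᵀ * X) := by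
    have e1 : Xᵀ * B * (Bᵀ * (B * (Bᵀ * X))) = Xᵀ * B * (Bᵀ * X) := by
      rw [← Matrix.mul_assoc Bᵀ B, hB, Matrix.one_mul]
    simp only [Matrix.transpose_sub, Matrix.transpose_mul, Matrix.transpose_transpose,
      Matrix.sub_mul, Matrix.mul_sub]
    simp only [Matrix.mul_assoc] at e1 ⊢
    rw [e1]
    abel
  have h1 := frobSq_eq_trace_transpose_mul (X - B * Bᵀ * X)
  rw [e, Matrix.trace_sub, ← frobSq_eq_trace_transpose_mul,
    ← frobSq_eq_trace_transpose_mul] at h1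
  have := frobSq_nonneg (Bᵀ * X)
  linarith

/-- The distance to a space is at most the distance to any matrix with columns in that space. -/
theorem subspaceDist_le_frobSq_sub {N n k : ℕ} {Q : Matrix (Fin N) (Fin n) ℝ}
    (hQ : Qᵀ * Q = 1) (A : Matrix (Fin N) (Fin k) ℝ) (Z : Matrix (Fin k) (Fin n) ℝ) :
    subspaceDist (colSpace Q) (colSpace A) ≤ frobSq (Q - A * Z) := by
  set B := basisMatrix (colSpace A) with hB
  have hBB : Bᵀ * B = 1 := basisMatrix_orthonormal _
  have hmem : ∀ j : Fin n, ∃ y : Fin _ → ℝ, ∀ i, (A * Z) i j = (B *ᵥ y) i := fun j => by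
    have h1 : (WithLp.toLp 2 (fun i => (A * Z) i j) : EuclideanSpace ℝ (Fin N)) ∈ colSpace A :=
      (mem_colSpace_iff A _).mpr ⟨fun l => Z l j, fun i => rfl⟩
    rw [← colSpace_basisMatrix (colSpace A), ← hB] at h1
    exact (mem_colSpace_iff B _).mp h1
  choose y hy using hmem
  have hW : A * Z = B * Matrix.of fun a b => y b a := by
    ext i j
    rw [hy]
    simp [Matrix.mulVec, dotProduct, Matrix.mul_apply']
  have hproj : B * Bᵀ * (A * Z) = A * Z := by
    rw [hW, Matrix.mul_assoc, ← Matrix.mul_assoc Bᵀ, hBB, Matrix.one_mul]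
  have h := frobSq_sub_projection_le hBB (Q - A * Z)
  rw [Matrix.mul_sub, hproj] at h
  rw [← colSpace_basisMatrix (colSpace A), ← hB, subspaceDist_colSpace Q B hQ hBB]
  refine le_of_eq_of_le ?_ h
  congr 1
  abel

theorem finrank_colSpace_eq_of_isUnit {N n : ℕ} {A : Matrix (Fin N) (Fin n) ℝ}
    {B : Matrix (Fin n) (Fin N) ℝ} (h : IsUnit (B * A)) :
    Module.finrank ℝ (colSpace A) = n := by
  have hinj : LinearIndependent ℝ fun j => (WithLp.toLp 2 (fun i => A i j) :
      EuclideanSpace ℝ (Fin N)) := by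
    rw [Fintype.linearIndependent_iff]
    intro g hg
    have hAg : A *ᵥ g = 0 := by
      ext i
      have := congrArg (fun v : EuclideanSpace ℝ (Fin N) => v i) hg
      simpa [Matrix.mulVec, dotProduct, mul_comm] using this
    have h0 : (B * A) *ᵥ g = 0 := by rw [← Matrix.mulVec_mulVec, hAg, Matrix.mulVec_zero]
    have := Matrix.mulVec_injective_of_isUnit h (h0.trans (Matrix.mulVec_zero _).symm)
    exact fun i => congrFun this i
  rw [colSpace, finrank_span_eq_card hinj, Fintype.card_fin]

/-! ### Adaptive sampling and tails of the decay. -/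

/-- The part of a matrix in the rows outside the points `s`. -/
def rowsOff {N m w : ℕ} (s : Fin m → Fin N) (R : Matrix (Fin N) (Fin w) ℝ) :
    Matrix (Fin N) (Fin w) ℝ :=
  open Classical in Matrix.of fun i => if i ∈ Set.range s then 0 else R i

theorem rowsOff_of_mem {N m w : ℕ} {s : Fin m → Fin N} (R : Matrix (Fin N) (Fin w) ℝ) {i : Fin N}
    (hi : i ∈ Set.range s) : rowsOff s R i = 0 :=
  if_pos hi

theorem rowsOff_of_notMem {N m w : ℕ} {s : Fin m → Fin N} (R : Matrix (Fin N) (Fin w) ℝ)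
    {i : Fin N} (hi : i ∉ Set.range s) : rowsOff s R i = R i :=
  if_neg hi

theorem IsAdaptiveSampling.injective {N w m : ℕ} {hm : m ≤ N} {R : Matrix (Fin N) (Fin w) ℝ}
    {s : Fin m → Fin N} (h : IsAdaptiveSampling hm R s) : Function.Injective s := by
  obtain ⟨σ, -, hs⟩ := h
  intro a b hab
  rw [hs, hs] at hab
  exact Fin.castLE_injective hm (σ.injective hab)

/-- Adaptive sampling leaves the smallest possible residual. -/
theorem IsAdaptiveSampling.sum_rowResidual_le {N w m : ℕ} {hm : m ≤ N}
    {R : Matrix (Fin N) (Fin w) ℝ} {s : Fin m → Fin N} (h : IsAdaptiveSampling hm R s)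
    (j : Equiv.Perm (Fin N)) :
    frobSq (rowsOff s R) ≤
      ∑ l : Fin N, if (l : ℕ) < m then 0 else rowResidual R (j l) := by
  obtain ⟨σ, hσ, hs⟩ := h
  set f : Fin N → ℝ := fun l => if (l : ℕ) < m then 0 else 1 with hf
  have hmem : ∀ l : Fin N, σ l ∈ Set.range s ↔ (l : ℕ) < m := fun l => by
    constructor
    · rintro ⟨k, hk⟩
      rw [hs] at hk
      rw [← σ.injective hk]
      exact k.2
    · intro hl
      exact ⟨⟨l, hl⟩, by rw [hs]; rfl⟩
  have hanti : Antivary f fun l => rowResidual R (σ l) := by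
    intro a b hab
    have hba : b < a := by
      by_contra hcon
      exact absurd (hσ (not_lt.mp hcon)) (not_le.mpr hab)
    have hba' : (b : ℕ) < a := hba
    simp only [hf]
    split_ifs <;> first | omega | norm_num
  -- Rearrangement inequality: the indicator of the unsampled positions is increasing and the sorted
  -- residuals are decreasing, so any other ordering gives a larger sum.
  have hre := hanti.sum_mul_le_sum_mul_comp_perm (σ := j.trans σ.symm)
  have h1 : frobSq (rowsOff s R) = ∑ l, f l * rowResidual R (σ l) := by
    rw [frobSq, ← Equiv.sum_comp σ]
    refine Finset.sum_congr rfl fun l _ => ?_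
    by_cases hl : (l : ℕ) < m
    · rw [rowsOff_of_mem R ((hmem l).mpr hl)]
      simp [hf, hl]
    · rw [rowsOff_of_notMem R (mt (hmem l).mp hl)]
      simp [hf, hl, rowResidual]
  have h2 : (∑ l : Fin N, if (l : ℕ) < m then 0 else rowResidual R (j l)) =
      ∑ l, f l * rowResidual R (σ ((j.trans σ.symm) l)) := by
    refine Finset.sum_congr rfl fun l _ => ?_
    by_cases hl : (l : ℕ) < m <;> simp [hf, hl]
  rw [h1, h2]
  exact hre

/-- A super-exponentially decaying sequence has a tail comparable to its leading term. -/
theorem sum_tail_exp_rpow_le {c a : ℝ} (hc : 0 < c) (ha : 1 ≤ a) {N m : ℕ} (hm : m ≤ N) :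
    (∑ l : Fin N, if (l : ℕ) < m then 0 else Real.exp (-c * ((l : ℝ) + 1) ^ a)) ≤
      (1 - Real.exp (-c))⁻¹ * Real.exp (-c * (m : ℝ) ^ a) := by
  have hr1 : Real.exp (-c) < 1 := Real.exp_lt_one_iff.mpr (by linarith)
  have hr0 : 0 ≤ Real.exp (-c) := (Real.exp_pos _).le
  -- Superadditivity of `t ↦ t ^ a` for `a ≥ 1` gives `(m + k + 1) ^ a ≥ m ^ a + k`, hence a
  -- geometric series whose ratio does not depend on `a`.
  have hterm : ∀ k : ℕ, Real.exp (-c * (((m + k : ℕ) : ℝ) + 1) ^ a) ≤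
      Real.exp (-c * (m : ℝ) ^ a) * Real.exp (-c) ^ k := fun k => by
    rw [← Real.exp_nat_mul, ← Real.exp_add, Real.exp_le_exp]
    have h1 := Real.add_rpow_le_rpow_add (a := (m : ℝ)) (b := (k : ℝ) + 1) (p := a)
      (by positivity) (by positivity) ha
    have h2 : (k : ℝ) + 1 ≤ ((k : ℝ) + 1) ^ a :=
      Real.self_le_rpow_of_one_le (by linarith [Nat.cast_nonneg (α := ℝ) k]) ha
    have h3 : (m : ℝ) ^ a + k ≤ (((m + k : ℕ) : ℝ) + 1) ^ a := by
      push_cast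
      rw [add_assoc]
      linarith
    nlinarith
  rw [Fin.sum_univ_eq_sum_range
    (fun l : ℕ => if l < m then (0 : ℝ) else Real.exp (-c * ((l : ℝ) + 1) ^ a)) N,
    ← Finset.sum_range_add_sum_Ico _ hm, Finset.sum_Ico_eq_sum_range,
    Finset.sum_eq_zero (fun l hl => if_pos (Finset.mem_range.mp hl)), zero_add]
  calc _ ≤ ∑ k ∈ Finset.range (N - m),
        Real.exp (-c * (m : ℝ) ^ a) * Real.exp (-c) ^ k := by
        refine Finset.sum_le_sum fun k _ => ?_
        rw [if_neg (by omega)]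
        exact hterm k
    _ = Real.exp (-c * (m : ℝ) ^ a) * ∑ k ∈ Finset.range (N - m), Real.exp (-c) ^ k :=
        (Finset.mul_sum _ _ _).symm
    _ ≤ Real.exp (-c * (m : ℝ) ^ a) * (1 - Real.exp (-c))⁻¹ := by
        refine mul_le_mul_of_nonneg_left ?_ (Real.exp_nonneg _)
        rw [← tsum_geometric_of_lt_one hr0 hr1]
        exact (summable_geometric_of_lt_one hr0 hr1).sum_le_tsum _ fun _ _ => by positivity
    _ = _ := mul_comm _ _

/-- Inverts the threshold on the number of sampling points; the maximum with `0` keeps the base of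
the real power nonnegative. -/
theorem exp_neg_rpow_le_of_threshold {c A y x : ℝ} (hc : 0 < c) (hA : 0 < A) (hy : 0 < y)
    (h : (max 0 (-(1 / c) * Real.log y)) ^ (1 / A) ≤ x) : Real.exp (-c * x ^ A) ≤ y := by
  have hM : 0 ≤ max 0 (-(1 / c) * Real.log y) := le_max_left _ _
  have h1 := Real.rpow_le_rpow (Real.rpow_nonneg hM _) h hA.le
  rw [← Real.rpow_mul hM, one_div_mul_cancel hA.ne', Real.rpow_one] at h1
  have h2 := (le_max_right _ _).trans h1
  rw [← Real.le_log_iff_exp_le hy]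
  have h3 := mul_le_mul_of_nonneg_left h2 hc.le
  have e : c * (-(1 / c) * Real.log y) = -Real.log y := by field_simp
  rw [e] at h3
  linarith

/-! ### The interpolation residual and local coherence. -/

theorem rowResidual_eq_of_localCoherence {N n : ℕ} (hn : 1 ≤ n) {Q : Matrix (Fin N) (Fin n) ℝ}
    (hQ : Qᵀ * Q = 1) (i : Fin N) :
    rowResidual Q i = n / N * localCoherence (colSpace Q) i := by
  have hN : (N : ℝ) ≠ 0 := Nat.cast_ne_zero.mpr (Fin.pos i).ne'
  have hn' : (n : ℝ) ≠ 0 := Nat.cast_ne_zero.mpr (by omega)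
  rw [localCoherence_colSpace Q hQ, rowResidual]
  field_simp

/-- Separates the random factor from the deterministic residual of the target basis. -/
theorem deimResidual_mul {N n w v : ℕ} (U : Matrix (Fin N) (Fin n) ℝ) (p : Fin n → Fin N)
    (F : Matrix (Fin N) (Fin w) ℝ) (G : Matrix (Fin w) (Fin v) ℝ) :
    deimResidual U p (F * G) = deimResidual U p F * G := by
  simp only [deimResidual, deimCoeff, Matrix.sub_mul, Matrix.mul_assoc]

theorem deimResidual_interpolation {N n w : ℕ} {U : Matrix (Fin N) (Fin n) ℝ}
    {p : Fin n → Fin N} (hp : IsUnit ((pointsMatrix p)ᵀ * U)) (F : Matrix (Fin N) (Fin w) ℝ)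
    (l : Fin n) (j : Fin w) : deimResidual U p F (p l) j = 0 := by
  have hdet := (Matrix.isUnit_iff_isUnit_det _).mp hp
  have h : (pointsMatrix p)ᵀ * deimResidual U p F = 0 := by
    rw [deimResidual, deimCoeff, Matrix.mul_sub, ← Matrix.mul_assoc _ U,
      Matrix.mul_nonsing_inv_cancel_left _ _ hdet, sub_self]
  rw [← pointsMatrix_transpose_mul_apply p (deimResidual U p F), h, Matrix.zero_apply]

theorem rowResidual_sub_le {N w : ℕ} (A B : Matrix (Fin N) (Fin w) ℝ) (i : Fin N) :
    rowResidual (A - B) i ≤ 2 * rowResidual A i + 2 * rowResidual B i := by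
  rw [rowResidual, rowResidual, rowResidual, Finset.mul_sum, Finset.mul_sum,
    ← Finset.sum_add_distrib]
  refine Finset.sum_le_sum fun l _ => ?_
  rw [Matrix.sub_apply]
  nlinarith [sq_nonneg (A i l + B i l)]

/-- In the bound for the coefficients, one factor `n` comes from passing from the spectral to the
Frobenius norm, the other from the `n` interpolated rows of `Q`, each of norm at most one. -/
theorem rowResidual_deimResidual_le {N n : ℕ} {U Q : Matrix (Fin N) (Fin n) ℝ}
    {p : Fin n → Fin N} (hQ : Qᵀ * Q = 1) (i : Fin N) :
    rowResidual (deimResidual U p Q) i ≤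
      2 * (n ^ 2 * spectralNorm2 ((pointsMatrix p)ᵀ * U)⁻¹ ^ 2) * rowResidual U i +
        2 * rowResidual Q i := by
  have hPQ : frobSq ((pointsMatrix p)ᵀ * Q) ≤ n := by
    calc frobSq ((pointsMatrix p)ᵀ * Q) = ∑ l, rowResidual Q (p l) := by
          simp only [frobSq, rowResidual, pointsMatrix_transpose_mul_apply]
      _ ≤ ∑ _l : Fin n, (1 : ℝ) :=
          Finset.sum_le_sum fun l _ => rowResidual_le_one_of_orthonormal hQ _
      _ = n := by simp
  have hC : frobSq (deimCoeff U p Q) ≤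
      n ^ 2 * spectralNorm2 ((pointsMatrix p)ᵀ * U)⁻¹ ^ 2 := by
    refine (frobSq_mul_le _ _).trans ?_
    refine (mul_le_mul (frobSq_le_card_mul_spectralNorm2_sq _) hPQ (frobSq_nonneg _)
      (by positivity)).trans (le_of_eq (by ring))
  have h1 := rowResidual_sub_le (U * deimCoeff U p Q) Q i
  have h2 := (rowResidual_mul_le U (deimCoeff U p Q) i).trans
    (mul_le_mul_of_nonneg_left hC (rowResidual_nonneg U i))
  rw [deimResidual]
  linarith

theorem isUnit_of_rank_eq {n : ℕ} {A : Matrix (Fin n) (Fin n) ℝ} (h : A.rank = n) :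
    IsUnit A := by
  have hr : LinearMap.range A.mulVecLin = ⊤ := by
    refine Submodule.eq_top_of_finrank_eq ?_
    rw [Module.finrank_fin_fun]
    exact h
  rw [← Matrix.mulVec_surjective_iff_isUnit]
  exact LinearMap.range_eq_top.mp hr

/-! ### Error of the full-rank update. -/

/-- A full-rank update reproduces the right-hand side up to the residual that remains off the
sampling points. -/
theorem IsADEIMUpdate.mul_coeff_eq {N n m r : ℕ} {U : Matrix (Fin N) (Fin n) ℝ}
    {C : Matrix (Fin n) (Fin n) ℝ} {F : Matrix (Fin N) (Fin n) ℝ} {s : Fin m → Fin N}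
    (hC : IsUnit C.det) (hs : Function.Injective s)
    (hr : r = ((pointsMatrix s)ᵀ * (U * C - F)).rank)
    {α : Matrix (Fin N) (Fin r) ℝ} {β : Matrix (Fin n) (Fin r) ℝ}
    (h : IsADEIMUpdate U C F s α β) :
    (U + α * βᵀ) * C = F + rowsOff s (U * C - F) := by
  ext i j
  by_cases hi : i ∈ Set.range s
  · rw [Matrix.add_apply, rowsOff_of_mem _ hi, Pi.zero_apply, add_zero]
    obtain ⟨l, rfl⟩ := hi
    exact h.residual_eq_zero hC hs hr l j
  · have h0 : (α * βᵀ * C) i j = 0 := by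
      rw [Matrix.mul_apply]
      exact Finset.sum_eq_zero fun l _ => by rw [h.eq_zero_off i hi l, zero_mul]
    rw [Matrix.add_mul, Matrix.add_apply, h0, add_zero, Matrix.add_apply,
      rowsOff_of_notMem _ hi, Matrix.sub_apply]
    ring

/-- A full-rank update whose coefficients are regular spans an `n`-dimensional space, and
the distance to it is controlled by the residual that remains off the sampling points. -/
theorem IsADEIMUpdate.finrank_and_subspaceDist_le {N n m r : ℕ} {U Q : Matrix (Fin N) (Fin n) ℝ}
    {p : Fin n → Fin N} (hQ : Qᵀ * Q = 1) (hU : IsUnit ((pointsMatrix p)ᵀ * U))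
    (hQp : ((pointsMatrix p)ᵀ * Q).rank = n) {G : Matrix (Fin n) (Fin n) ℝ} (hG : IsUnit G.det)
    {s : Fin m → Fin N} (hs : Function.Injective s)
    (hr : r = ((pointsMatrix s)ᵀ * deimResidual U p (Q * G)).rank)
    {α : Matrix (Fin N) (Fin r) ℝ} {β : Matrix (Fin n) (Fin r) ℝ}
    (h : IsADEIMUpdate U (deimCoeff U p (Q * G)) (Q * G) s α β) :
    Module.finrank ℝ (colSpace (U + α * βᵀ)) = n ∧
      subspaceDist (colSpace Q) (colSpace (U + α * βᵀ)) ≤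
        frobSq (rowsOff s (deimResidual U p (Q * G))) * frobSq G⁻¹ := by
  have hPF : IsUnit ((pointsMatrix p)ᵀ * (Q * G)) := by
    rw [← Matrix.mul_assoc]
    exact (isUnit_of_rank_eq hQp).mul ((Matrix.isUnit_iff_isUnit_det _).mpr hG)
  have hCu : IsUnit (deimCoeff U p (Q * G)) :=
    (Matrix.isUnit_nonsing_inv_iff.mpr hU).mul hPF
  have hUC := h.mul_coeff_eq ((Matrix.isUnit_iff_isUnit_det _).mp hCu) hs hr
  rw [← deimResidual] at hUC
  constructor
  -- At an interpolation point the remaining residual is zero, whether or not the point is sampled.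
  · have h1 : (pointsMatrix p)ᵀ * (U + α * βᵀ) * deimCoeff U p (Q * G) =
        (pointsMatrix p)ᵀ * (Q * G) := by
      rw [Matrix.mul_assoc, hUC]
      ext l j
      rw [pointsMatrix_transpose_mul_apply, pointsMatrix_transpose_mul_apply, Matrix.add_apply,
        add_eq_left]
      by_cases hl : p l ∈ Set.range s
      · rw [rowsOff_of_mem _ hl, Pi.zero_apply]
      · rw [rowsOff_of_notMem _ hl, deimResidual_interpolation hU]
    rw [← h1] at hPF
    refine finrank_colSpace_eq_of_isUnit (B := (pointsMatrix p)ᵀ) ?_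
    rw [Matrix.isUnit_iff_isUnit_det] at hPF ⊢
    rw [Matrix.det_mul] at hPF
    exact isUnit_of_mul_isUnit_left hPF
  -- With these coefficients the approximation of `Q` is off by exactly the remaining residual times
  -- `G⁻¹`.
  · refine (subspaceDist_le_frobSq_sub hQ (U + α * βᵀ) (deimCoeff U p (Q * G) * G⁻¹)).trans ?_
    have e : Q - (U + α * βᵀ) * (deimCoeff U p (Q * G) * G⁻¹) =
        -(rowsOff s (deimResidual U p (Q * G)) * G⁻¹) := by
      rw [← Matrix.mul_assoc, hUC, Matrix.add_mul, Matrix.mul_nonsing_inv_cancel_right _ _ hG]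
      abel
    rw [e, frobSq_neg]
    exact frobSq_mul_le _ _

/-- The residual of adaptive sampling off the sampling points, for coherence that decays along an
ordering of the points. -/
theorem IsAdaptiveSampling.frobSq_rowsOff_le {N n m : ℕ} (hn : 1 ≤ n) {hm : m ≤ N}
    {U Q G} {p : Fin n → Fin N} {s : Fin m → Fin N} {c₄ c₄' c₅ c₅' a a' Λ : ℝ}
    (hc₄ : 0 < c₄) (hc₄' : 0 < c₄') (hc₅ : 0 < c₅) (hc₅' : 0 < c₅') (ha : 1 < a) (ha' : 1 < a')
    (hU : Uᵀ * U = 1) (hQ : Qᵀ * Q = 1)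
    (hΛ : spectralNorm2 ((pointsMatrix p)ᵀ * U)⁻¹ = Λ) (j : Equiv.Perm (Fin N))
    (h₁ : ∀ i : Fin N, localCoherence (colSpace U) (j i) ≤
      c₄ * Real.exp (-c₅ * ((i : ℝ) + 1) ^ a))
    (h₂ : ∀ i : Fin N, localCoherence (colSpace Q) (j i) ≤
      c₄' * Real.exp (-c₅' * ((i : ℝ) + 1) ^ a'))
    (hs : IsAdaptiveSampling hm (deimResidual U p (Q * G)) s) :
    frobSq (rowsOff s (deimResidual U p (Q * G))) ≤
      n / N * (2 * (n ^ 2 * Λ ^ 2) * c₄ + 2 * c₄') * (1 - Real.exp (-min c₅ c₅'))⁻¹ *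
        Real.exp (-min c₅ c₅' * (m : ℝ) ^ min a a') * frobSq (G : Matrix (Fin n) (Fin n) ℝ) := by
  set c := min c₅ c₅' with hc
  set A := min a a' with hA
  set K := 2 * (n ^ 2 * Λ ^ 2) * c₄ + 2 * c₄' with hK
  -- Positions count from one, so the base `l + 1` is at least `1` and a smaller exponent gives
  -- slower decay.
  have hdecay : ∀ (l : Fin N) {c₁ a₁ : ℝ}, c ≤ c₁ → A ≤ a₁ →
      Real.exp (-c₁ * ((l : ℝ) + 1) ^ a₁) ≤ Real.exp (-c * ((l : ℝ) + 1) ^ A) := by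
    intro l c₁ a₁ hc₁ ha₁
    have h1 : (1 : ℝ) ≤ (l : ℝ) + 1 := by linarith [Nat.cast_nonneg (α := ℝ) (l : ℕ)]
    have h2 := Real.rpow_le_rpow_of_exponent_le h1 ha₁
    have h3 : (0 : ℝ) ≤ ((l : ℝ) + 1) ^ A := by positivity
    have h4 : 0 < c := lt_min hc₅ hc₅'
    rw [Real.exp_le_exp, neg_mul, neg_mul, neg_le_neg_iff]
    exact mul_le_mul hc₁ h2 h3 (h4.le.trans hc₁)
  have hrow : ∀ l : Fin N, rowResidual (deimResidual U p (Q * G)) (j l) ≤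
      n / N * K * frobSq G * Real.exp (-c * ((l : ℝ) + 1) ^ A) := by
    intro l
    set x := Real.exp (-c * ((l : ℝ) + 1) ^ A) with hx
    have hγ : localCoherence (colSpace U) (j l) ≤ c₄ * x :=
      (h₁ l).trans (mul_le_mul_of_nonneg_left (hdecay l (min_le_left _ _) (min_le_left _ _)) hc₄.le)
    have hγ' : localCoherence (colSpace Q) (j l) ≤ c₄' * x :=
      (h₂ l).trans
        (mul_le_mul_of_nonneg_left (hdecay l (min_le_right _ _) (min_le_right _ _)) hc₄'.le)
    have hnN : (0 : ℝ) ≤ n / N := by positivity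
    have h3 := rowResidual_deimResidual_le (U := U) (p := p) hQ (j l)
    rw [hΛ] at h3
    have h4 : rowResidual U (j l) ≤ n / N * (c₄ * x) := by
      rw [rowResidual_eq_of_localCoherence hn hU]
      exact mul_le_mul_of_nonneg_left hγ hnN
    have h5 : rowResidual Q (j l) ≤ n / N * (c₄' * x) := by
      rw [rowResidual_eq_of_localCoherence hn hQ]
      exact mul_le_mul_of_nonneg_left hγ' hnN
    have h6 : rowResidual (deimResidual U p Q) (j l) ≤ n / N * K * x := by
      have h7 : 2 * (n ^ 2 * Λ ^ 2) * rowResidual U (j l) ≤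
          2 * (n ^ 2 * Λ ^ 2) * (n / N * (c₄ * x)) :=
        mul_le_mul_of_nonneg_left h4 (by positivity)
      calc _ ≤ 2 * (n ^ 2 * Λ ^ 2) * (n / N * (c₄ * x)) + 2 * (n / N * (c₄' * x)) := by linarith
        _ = n / N * K * x := by rw [hK]; ring
    rw [deimResidual_mul]
    calc _ ≤ rowResidual (deimResidual U p Q) (j l) * frobSq G := rowResidual_mul_le _ _ _
      _ ≤ n / N * K * x * frobSq G := mul_le_mul_of_nonneg_right h6 (frobSq_nonneg _)
      _ = _ := by ring
  have hB : 0 ≤ n / N * K * frobSq G := by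
    have := frobSq_nonneg G
    positivity
  calc _ ≤ ∑ l : Fin N, if (l : ℕ) < m then 0 else
        rowResidual (deimResidual U p (Q * G)) (j l) := hs.sum_rowResidual_le j
    _ ≤ ∑ l : Fin N, n / N * K * frobSq G *
        (if (l : ℕ) < m then 0 else Real.exp (-c * ((l : ℝ) + 1) ^ A)) := by
        refine Finset.sum_le_sum fun l _ => ?_
        split_ifs
        · simp
        · exact hrow l
    _ = n / N * K * frobSq G *
        ∑ l : Fin N, if (l : ℕ) < m then 0 else Real.exp (-c * ((l : ℝ) + 1) ^ A) :=
        (Finset.mul_sum _ _ _).symm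
    _ ≤ n / N * K * frobSq G * ((1 - Real.exp (-c))⁻¹ * Real.exp (-c * (m : ℝ) ^ A)) :=
        mul_le_mul_of_nonneg_left
          (sum_tail_exp_rpow_le (lt_min hc₅ hc₅') (le_min ha.le ha'.le) hm) hB
    _ = _ := by ring

theorem IsAdaptiveSampling.rowsOff_eq_zero {N w m : ℕ} {hm : m ≤ N}
    {R : Matrix (Fin N) (Fin w) ℝ} {s : Fin m → Fin N} (h : IsAdaptiveSampling hm R s)
    (hmN : m = N) : rowsOff s R = 0 := by
  subst hmN
  ext i k
  rw [rowsOff_of_mem R (Finite.surjective_of_injective h.injective i)]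
  rfl

/-! ### Choice of the constant and conclusion. -/

theorem proposition3p5 (n : ℕ) (Λ c₄ c₄' c₅ c₅' : ℝ)
    (hc₄ : 0 < c₄) (hc₄' : 0 < c₄') (hc₅ : 0 < c₅) (hc₅' : 0 < c₅') :
    -- the constant depends on `n`, `Λ` and the coherence constants only
    ∃ c₈ : ℝ, 0 < c₈ ∧
      ∀ (N m : ℕ) (hm : m ≤ N) (a a' ε δ : ℝ), 1 < a → 1 < a' → 0 < ε → 0 < δ →
      ∀ (U Ubar : Matrix (Fin N) (Fin n) ℝ) (p : Fin n → Fin N) (j : Equiv.Perm (Fin N)),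
        Uᵀ * U = 1 → Ubarᵀ * Ubar = 1 →
        -- interpolation points
        IsUnit ((pointsMatrix p)ᵀ * U) →
        spectralNorm2 ((pointsMatrix p)ᵀ * U)⁻¹ = Λ →
        ((pointsMatrix p)ᵀ * Ubar).rank = n →
        -- decay of the local coherence
        (∀ i : Fin N, localCoherence (colSpace U) (j i) ≤
          c₄ * Real.exp (-c₅ * ((i : ℝ) + 1) ^ a)) →
        (∀ i : Fin N, localCoherence (colSpace Ubar) (j i) ≤
          c₄' * Real.exp (-c₅' * ((i : ℝ) + 1) ^ a')) →
        -- number of sampling points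
        min (N : ℝ)
          ((max 0 (-(1 / min c₅ c₅') * Real.log (ε * δ ^ 2 * N / (c₈ * n)))) ^
            (1 / min a a')) ≤ (m : ℝ) →
      ∀ {Ω : Type*} [MeasurableSpace Ω] (μ : MeasureTheory.Measure Ω)
        [MeasureTheory.IsProbabilityMeasure μ] (Ft : Ω → Matrix (Fin n) (Fin n) ℝ),
        -- i.i.d. standard Gaussian entries
        (∀ x y, ProbabilityTheory.HasLaw (fun ω => Ft ω x y)
          (ProbabilityTheory.gaussianReal 0 1) μ) →
        ProbabilityTheory.iIndepFun (fun (q : Fin n × Fin n) ω => Ft ω q.1 q.2) μ →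
      ∃ E : Set Ω, MeasurableSet E ∧ ENNReal.ofReal (1 - δ) ≤ μ E ∧
        ∀ ω ∈ E, ∀ (F R : Matrix (Fin N) (Fin n) ℝ),
          F = Ubar * Ft ω → R = deimResidual U p F →
          ∀ s : Fin m → Fin N, IsAdaptiveSampling hm R s →
          -- full-rank update
          ∀ r : ℕ, r = ((pointsMatrix s)ᵀ * R).rank →
          ∀ (α : Matrix (Fin N) (Fin r) ℝ) (β : Matrix (Fin n) (Fin r) ℝ),
            IsADEIMUpdate U (deimCoeff U p F) F s α β →
            Module.finrank ℝ (colSpace (U + α * βᵀ)) = n ∧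
              subspaceDist (colSpace Ubar) (colSpace (U + α * βᵀ)) ≤ ε := by

  have hc : 0 < min c₅ c₅' := lt_min hc₅ hc₅'
  have hr : 0 < (1 - Real.exp (-min c₅ c₅'))⁻¹ :=
    inv_pos.mpr (sub_pos.mpr (Real.exp_lt_one_iff.mpr (by linarith)))
  set K := 2 * ((n : ℝ) ^ 2 * Λ ^ 2) * c₄ + 2 * c₄' with hK
  have hK0 : 0 < K := by positivity
  -- Row bound, times geometric tail, times condition number; the `+ 1` keeps the constant positive
  -- for `n = 0`.
  refine ⟨K * (1 - Real.exp (-min c₅ c₅'))⁻¹ * (64 * n ^ 10 + 1), by positivity, ?_⟩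
  intro N m hm a a' ε δ ha ha' hε hδ U Ubar p j hU hUbar hp hΛ hpbar h₁ h₂ hthr Ω _ μ _ Ft
    hlaw hind
  rcases Nat.eq_zero_or_pos n with hn | hn
  · subst hn
    refine ⟨Set.univ, MeasurableSet.univ, ?_, ?_⟩
    · rw [MeasureTheory.measure_univ, ENNReal.ofReal_le_one]
      linarith
    · intro ω _ F R _ _ s _ r _ α β _
      refine ⟨finrank_colSpace_eq_of_isUnit (B := 0) (isUnit_of_subsingleton _), ?_⟩
      refine (subspaceDist_le_frobSq_sub hUbar _ 0).trans ?_
      simpa [frobSq] using hε.le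
  obtain ⟨E, hE, hμE, hcond⟩ := exists_measurableSet_gaussian_condition μ hn Ft hlaw hind hδ
  refine ⟨E, hE, hμE, ?_⟩
  rintro ω hω F R rfl rfl s hs r hrank α β hup
  obtain ⟨hdet, hκ⟩ := hcond ω hω
  obtain ⟨hfin, hdist⟩ := hup.finrank_and_subspaceDist_le hUbar hp hpbar hdet hs.injective hrank
  refine ⟨hfin, hdist.trans ?_⟩
  -- If every point is sampled, no residual remains. Otherwise `m < N`, and the minimum in the
  -- threshold must be its second argument.
  rcases hm.eq_or_lt with hmN | hmN
  · rw [hs.rowsOff_eq_zero hmN, frobSq_eq_zero_iff.mpr rfl, zero_mul]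
    exact hε.le
  have hN : (0 : ℝ) < N := Nat.cast_pos.mpr (by omega)
  have hn' : (0 : ℝ) < n := Nat.cast_pos.mpr hn
  have hthr' := (min_le_iff.mp hthr).resolve_left (by
    rw [not_le]; exact_mod_cast hmN)
  have hexp := exp_neg_rpow_le_of_threshold hc (lt_min (by linarith) (by linarith))
    (by positivity) hthr'
  have hoff := hs.frobSq_rowsOff_le hn hc₄ hc₄' hc₅ hc₅' ha ha' hU hUbar hΛ j h₁ h₂
  rw [← hK] at hoff
  set S := (1 - Real.exp (-min c₅ c₅'))⁻¹ with hS
  set x := Real.exp (-min c₅ c₅' * (m : ℝ) ^ min a a') with hx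
  have hx0 : 0 < x := Real.exp_pos _
  calc _ ≤ n / N * K * S * x * frobSq (Ft ω) * frobSq (Ft ω)⁻¹ :=
        mul_le_mul_of_nonneg_right hoff (frobSq_nonneg _)
    _ = n / N * K * S * x * (frobSq (Ft ω) * frobSq (Ft ω)⁻¹) := by ring
    _ ≤ n / N * K * S * x * ((64 * n ^ 10 + 1) / δ ^ 2) := by
        refine mul_le_mul_of_nonneg_left (hκ.trans ?_) (by positivity)
        gcongr
        linarith
    -- The threshold was set so that the exponential is at most this quotient, which cancels every
    -- other factor.
    _ ≤ n / N * K * S * (ε * δ ^ 2 * N / (K * S * (64 * n ^ 10 + 1) * n)) *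
        ((64 * n ^ 10 + 1) / δ ^ 2) := by
        gcongr
    _ = ε := by field_simp
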